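/- A set $X\subset\mathbb{R}^d$ ($d\ge 1$) is a Delone set if it is uniformly discrete (there is $r>0$ such that every open ball of radius $r$ contains at most one point of $X$) and relatively dense (there is $R>0$ such that every closed ball of radius $R$ contains at least one point of $X$). A Delone set $X$ is called finitely generated if the abelian group generated by $X-X=\{x-y: x,y\in X\}$ is finitely generated; of finite type if $X-X$ meets every ball in a finite set; a Meyer set if $X-X$ is uniformly discrete; and repetitive if for every $T>0$ there is $M>0$ such that every ball of radius $M$ contains a translated copy of every cluster of $X$ of radius $T$, that is, for every $y\in\mathbb{R}^d$ and every closed ball $B$ of radius $M$ there is $t\in\mathbb{R}^d$ with $X\cap \overline B(y+t,T)=t+(X\cap \overline B(y,T))\subseteq B$, where $\overline B(y,T)$ is the closed ball with center $y$ and radius $T$. Let $\eta>1$ be a real algebraic integer; its conjugates are the complex roots other than $\eta$ of its minimal polynomial over $\mathbb{Q}$. Then $\eta$ is called a Pisot number if all its conjugates $\eta'$ satisfy $|\eta'|<1$; a Salem number if all conjugates satisfy $|\eta'|\le 1$ and at least one satisfies $|\eta'|=1$; a Perron number if all conjugates satisfy $|\eta'|<\eta$; and a Lind number if all conjugates satisfy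 $|\eta'|\le\eta$ and at least one satisfies $|\eta'|=\eta$. Theorem. Let $d\ge 1$, let $X$ be a Delone set in $\mathbb{R}^d$, and let $\eta>1$ be a real number such that $\eta X\subseteq X$. (i) If $X$ is finitely generated, then $\eta$ is an algebraic integer. (ii) If $X$ is of finite type, then $\eta$ is a Perron number or a Lind number. (ii$'$) If $X$ is repetitive and of finite type, then $\eta$ is a Perron number. (iii) If $X$ is a Meyer set, then $\eta$ is a Pisot number or a Salem number. -/

import Mathlib

open scoped Pointwise NNReal ENNReal

/-- Euclidean space `ℝ^d`. -/
abbrev Euc (d : ℕ) : Type := EuclideanSpace ℝ (Fin d)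

/-- A set is uniformly discrete if its distinct points are separated by a fixed positive
distance. -/
def IsUniformlyDiscrete {d : ℕ} (S : Set (Euc d)) : Prop :=
  ∃ r : ℝ≥0, 0 < r ∧ Metric.IsSeparated (r : ℝ≥0∞) S

/-- A Delone set `X` is finitely generated if the additive group generated by `X - X` is
finitely generated. -/
def IsFinitelyGenerated {d : ℕ} (X : Delone.DeloneSet (Euc d)) : Prop :=
  (AddSubgroup.closure ((X : Set (Euc d)) - (X : Set (Euc d)))).FG

/-- A Delone set `X` is of finite type if `X - X` meets every ball in a finite set. -/
def IsFiniteType {d : ℕ} (X : Delone.DeloneSet (Euc d)) : Prop :=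
  ∀ (c : Euc d) (T : ℝ),
    (((X : Set (Euc d)) - (X : Set (Euc d))) ∩ Metric.closedBall c T).Finite

/-- A Delone set `X` is a Meyer set if `X - X` is uniformly discrete. -/
def IsMeyer {d : ℕ} (X : Delone.DeloneSet (Euc d)) : Prop :=
  IsUniformlyDiscrete ((X : Set (Euc d)) - (X : Set (Euc d)))

/-- The cluster of `X` of radius `T` around `y`. -/
def cluster {d : ℕ} (X : Delone.DeloneSet (Euc d)) (y : Euc d) (T : ℝ) : Set (Euc d) :=
  (X : Set (Euc d)) ∩ Metric.closedBall y T

/-- A Delone set `X` is repetitive if for every `T > 0` there is `M > 0` such that every ball of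
radius `M` contains a translated copy of every cluster of `X` of radius `T`: the translate
of the cluster around `y` by some `t` is the cluster of `X` around `y + t`, and lies in the ball. -/
def IsRepetitive {d : ℕ} (X : Delone.DeloneSet (Euc d)) : Prop :=
  ∀ T : ℝ, 0 < T → ∃ M : ℝ, 0 < M ∧ ∀ y c : Euc d, ∃ t : Euc d,
    cluster X (y + t) T = t +ᵥ cluster X y T ∧
    cluster X (y + t) T ⊆ Metric.closedBall c M

/-- The (complex) algebraic conjugates of an algebraic real number `η`: the roots other than `η`
of its minimal polynomial. -/
def conjugates (η : ℝ) : Set ℂ :=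
  {z | z ≠ (η : ℂ) ∧ Polynomial.aeval z (minpoly ℚ η) = 0}

/-- Real algebraic integers greater than one. -/
def IsExpandingInteger (η : ℝ) : Prop := IsIntegral ℤ η ∧ 1 < η

def IsPisot (η : ℝ) : Prop :=
  IsExpandingInteger η ∧ ∀ z ∈ conjugates η, ‖z‖ < 1

def IsSalem (η : ℝ) : Prop :=
  IsExpandingInteger η ∧ (∀ z ∈ conjugates η, ‖z‖ ≤ 1) ∧ ∃ z ∈ conjugates η, ‖z‖ = 1

def IsPerron (η : ℝ) : Prop :=
  IsExpandingInteger η ∧ ∀ z ∈ conjugates η, ‖z‖ < η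

def IsLind (η : ℝ) : Prop :=
  IsExpandingInteger η ∧ (∀ z ∈ conjugates η, ‖z‖ ≤ η) ∧ ∃ z ∈ conjugates η, ‖z‖ = η

/-! Let `z` be a conjugate of `η`. A real vector space is a vector space over `ℚ(η)`, so it carries
an additive map `ψ` to `ℂ` with `ψ (η • x) = z * ψ x`. As `X - X` is stable under `η`, the growth of
`ψ` along `η ^ n • v` measures `‖z‖`. No continuity of `ψ` is available; the geometry of `X`
replaces it.

For (i), `η` preserves a nonzero finitely generated group. Under finite type, finitely many short
differences generate all others, and chains of short steps bound `ψ` linearly on `X - X`, so `‖z‖ ≤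
η`.

For a Meyer set, `ψ` varies boundedly between nearby differences, so sampling it near each vector
gives a quasi-additive function, which nearly commutes with scaling by `η`. On `X - X` scaling by
`η` thus multiplies `ψ` by `z` and, up to a bounded error, by `η`; since `z ≠ η`, `ψ` is bounded
there and `‖z‖ ≤ 1`.

In the repetitive case suppose `‖z‖ = η`. Long differences approach the extremal ratio `‖ψ x‖ /
‖x‖`, with limiting directions `u` and `w`. An additive defect `H` is sublinear along them, yet
positive on some difference because `z ≠ η`. Copies of that difference occur everywhere, and a path
through them in direction `u` makes `H` grow linearly, a contradiction. -/

section General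

/-! ### Equivariant additive maps and relatively dense sets. -/

variable {E : Type*} [NormedAddCommGroup E] [NormedSpace ℝ E]

/-- A root `z` of the minimal polynomial of `η` is realized as the factor by which an additive
function on a real vector space, nonzero at a given vector, transforms under scaling by `η`. -/
theorem exists_addMonoidHom_smul_eq_mul {η : ℝ} {z : ℂ} (hη : IsIntegral ℚ η)
    (hz : Polynomial.aeval z (minpoly ℚ η) = 0) {v : E} (hv : v ≠ 0) :
    ∃ ψ : E →+ ℂ, (∀ x, ψ (η • x) = z * ψ x) ∧ ψ v ≠ 0 := by
  -- A `ℚ(η)`-linear functional nonzero at `v`, to be followed by the embedding of `ℚ(η)` sending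
  -- `η` to `z`.
  obtain ⟨f, hf⟩ := Module.Projective.exists_dual_ne_zero (IntermediateField.adjoin ℚ {η}) hv
  have hz' : z ∈ (minpoly ℚ η).aroots ℂ :=
    Polynomial.mem_aroots.2 ⟨minpoly.ne_zero hη, hz⟩
  set σ := (IntermediateField.algHomAdjoinIntegralEquiv ℚ hη).symm ⟨z, hz'⟩ with hσ
  have hσz : σ (IntermediateField.AdjoinSimple.gen ℚ η) = z :=
    IntermediateField.algHomAdjoinIntegralEquiv_symm_apply_gen ℚ hη ⟨z, hz'⟩
  refine ⟨(σ : _ →+ ℂ).comp f.toAddMonoidHom, fun x => ?_, ?_⟩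
  · have h : η • x = IntermediateField.AdjoinSimple.gen ℚ η • x := rfl
    simp [h, hσz]
  · simpa using hf

theorem AddMonoidHom.map_pow_smul_of_map_smul {η : ℝ} {z : ℂ} {ψ : E →+ ℂ}
    (hψ : ∀ x, ψ (η • x) = z * ψ x) (n : ℕ) (x : E) : ψ (η ^ n • x) = z ^ n * ψ x := by
  induction n with
  | zero => simp
  | succ n ih => rw [pow_succ', mul_smul, hψ, ih, pow_succ', mul_assoc]

theorem pow_smul_mem_of_smul_subset {η : ℝ} {D : Set E} (hD : ∀ x ∈ D, η • x ∈ D) {x : E}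
    (hx : x ∈ D) (n : ℕ) : η ^ n • x ∈ D := by
  induction n with
  | zero => simpa
  | succ n ih => rw [pow_succ', mul_smul]; exact hD _ ih

/-- In a relatively dense set, one can approach `x` from `y` by a bounded step. -/
theorem exists_mem_dist_le_of_relativelyDense {S : Set E} {R : ℝ}
    (hS : ∀ x, ∃ y ∈ S, dist x y ≤ R) {x y : E} (hxy : R + 1 ≤ dist x y) :
    ∃ q ∈ S, dist q y ≤ 2 * R + 1 ∧ dist x q ≤ dist x y - 1 := by
  have hR : 0 ≤ R := by
    obtain ⟨q, -, hq⟩ := hS x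
    exact dist_nonneg.trans hq
  have hd : 0 < dist x y := by linarith
  -- Aim at distance `R + 1` from `y`: an error of `R` still leaves a gain of `1` towards `x`.
  obtain ⟨q, hq, hdq⟩ := hS (AffineMap.lineMap y x ((R + 1) / dist x y))
  set p := AffineMap.lineMap y x ((R + 1) / dist x y) with hp
  have h0 : 0 ≤ (R + 1) / dist x y := by positivity
  have h1 : (R + 1) / dist x y ≤ 1 := (div_le_one hd).2 hxy
  have hpy : dist p y = R + 1 := by
    rw [hp, dist_lineMap_left, Real.norm_of_nonneg h0, dist_comm y x]
    field_simp
  have hpx : dist p x = dist x y - (R + 1) := by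
    rw [hp, dist_lineMap_right, Real.norm_of_nonneg (by linarith), dist_comm y x]
    field_simp
  refine ⟨q, hq, ?_, ?_⟩
  · have := dist_triangle_left q y p
    linarith
  · have := dist_triangle_left x q p
    linarith

/-- Any two points of a relatively dense set are joined by a chain of bounded steps. -/
theorem reflTransGen_of_relativelyDense {S : Set E} {R : ℝ}
    (hS : ∀ x, ∃ y ∈ S, dist x y ≤ R) {x y : E} (hx : x ∈ S) (hy : y ∈ S) :
    Relation.ReflTransGen (fun a b => b ∈ S ∧ dist a b ≤ 2 * R + 1) y x := by
  have hR : 0 ≤ R := by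
    obtain ⟨q, -, hq⟩ := hS x
    exact dist_nonneg.trans hq
  obtain ⟨n, hn⟩ := exists_nat_ge (dist x y)
  induction n generalizing y with
  | zero =>
    have : x = y := by simpa using hn
    rw [this]
  | succ n ih =>
    by_cases h : R + 1 ≤ dist x y
    · obtain ⟨q, hq, hqy, hxq⟩ := exists_mem_dist_le_of_relativelyDense hS h
      refine .head ⟨hq, by rwa [dist_comm]⟩ (ih hq ?_)
      push_cast at hn
      linarith
    · exact .single ⟨hx, by rw [dist_comm]; linarith⟩

/-- An additive function bounded on short differences of a relatively dense set grows at most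
linearly on all differences. -/
theorem norm_map_sub_le_of_relativelyDense {S : Set E} {R C : ℝ} {ψ : E →+ ℂ}
    (hS : ∀ x, ∃ y ∈ S, dist x y ≤ R)
    (hC : ∀ x ∈ S, ∀ y ∈ S, dist x y ≤ 2 * R + 1 → ‖ψ (x - y)‖ ≤ C)
    {x y : E} (hx : x ∈ S) (hy : y ∈ S) : ‖ψ (x - y)‖ ≤ C * (‖x - y‖ + 2) := by
  have hR : 0 ≤ R := by
    obtain ⟨q, -, hq⟩ := hS x
    exact dist_nonneg.trans hq
  have hC0 : 0 ≤ C := by simpa using hC x hx x hx (by simp; linarith)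
  have key (n : ℕ) : ∀ y ∈ S, dist x y ≤ n → ‖ψ (x - y)‖ ≤ C * (n + 1) := by
    induction n with
    | zero =>
      intro y hy hn
      have : x = y := by simpa using hn
      simp [this, hC0]
    | succ n ih =>
      intro y hy hn
      push_cast at hn ⊢
      have hn0 : (0 : ℝ) ≤ n := n.cast_nonneg
      by_cases h : R + 1 ≤ dist x y
      · obtain ⟨q, hq, hqy, hxq⟩ := exists_mem_dist_le_of_relativelyDense hS h
        have h1 := ih q hq (by linarith)
        have h2 := hC q hq y hy hqy
        have h3 : ψ (x - y) = ψ (x - q) + ψ (q - y) := by rw [← map_add]; simp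
        rw [h3]
        linarith [norm_add_le (ψ (x - q)) (ψ (q - y))]
      · have := hC x hx y hy (by linarith)
        nlinarith
  refine (key ⌈dist x y⌉₊ y hy (Nat.le_ceil _)).trans ?_
  have := Nat.ceil_lt_add_one (dist_nonneg (x := x) (y := y))
  rw [← dist_eq_norm]
  exact mul_le_mul_of_nonneg_left (by linarith) hC0

/-- The differences of a relatively dense set generate the same group as the short ones. -/
theorem closure_sub_eq_closure_short_sub {S : Set E} {R : ℝ}
    (hS : ∀ x, ∃ y ∈ S, dist x y ≤ R) :
    AddSubgroup.closure (S - S) =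
      AddSubgroup.closure ((S - S) ∩ Metric.closedBall 0 (2 * R + 1)) := by
  refine le_antisymm ((AddSubgroup.closure_le _).2 ?_)
    (AddSubgroup.closure_mono Set.inter_subset_left)
  rintro _ ⟨x, hx, y, hy, rfl⟩
  suffices h : ∀ x, Relation.ReflTransGen (fun a b => b ∈ S ∧ dist a b ≤ 2 * R + 1) y x →
      x ∈ S ∧ x - y ∈ AddSubgroup.closure ((S - S) ∩ Metric.closedBall 0 (2 * R + 1)) from
    (h x (reflTransGen_of_relativelyDense hS hx hy)).2
  intro x h
  induction h with
  | refl => exact ⟨hy, by simp⟩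
  | @tail b c _ hbc ih =>
    refine ⟨hbc.1, ?_⟩
    rw [← sub_add_sub_cancel c b y]
    refine add_mem (AddSubgroup.subset_closure ⟨Set.sub_mem_sub hbc.1 ih.1, ?_⟩) ih.2
    rw [mem_closedBall_zero_iff, ← dist_eq_norm, dist_comm]
    exact hbc.2

/-- Cayley–Hamilton for multiplication by `η` on the group generated by `D`; a nonzero real scalar
kills no nonzero vector. -/
theorem isIntegral_of_closure_fg {η : ℝ} {D : Set E} (hD : ∀ x ∈ D, η • x ∈ D)
    (hfg : (AddSubgroup.closure D).FG) {v : E} (hvD : v ∈ D) (hv : v ≠ 0) : IsIntegral ℤ η := by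
  refine isIntegral_of_smul_mem_submodule (AddSubgroup.toIntSubmodule (AddSubgroup.closure D))
    ?_ ?_ η ?_
  · rw [Submodule.ne_bot_iff]
    exact ⟨v, AddSubgroup.subset_closure hvD, hv⟩
  · rw [Submodule.fg_iff_addSubgroup_fg]
    exact hfg
  · intro n hn
    change n ∈ AddSubgroup.closure D at hn
    change η • n ∈ AddSubgroup.closure D
    induction hn using AddSubgroup.closure_induction with
    | mem x hx => exact AddSubgroup.subset_closure (hD x hx)
    | zero => simp
    | add x y _ _ hx hy => rw [smul_add]; exact add_mem hx hy
    | neg x _ hx => rw [smul_neg]; exact neg_mem hx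

/-- Along `η ^ n • v` the map grows like `‖z‖ ^ n`, while the linear bound allows only `η ^ n`. -/
theorem norm_le_of_norm_map_le {η C : ℝ} (hη : 1 < η) {z : ℂ} {ψ : E →+ ℂ}
    (hψ : ∀ x, ψ (η • x) = z * ψ x) {D : Set E} (hD : ∀ x ∈ D, η • x ∈ D)
    (hC : ∀ x ∈ D, ‖ψ x‖ ≤ C * (‖x‖ + 2)) {v : E} (hvD : v ∈ D) (hv : ψ v ≠ 0) : ‖z‖ ≤ η := by
  by_contra! h
  have hη0 : 0 < η := by linarith
  have hbound (n : ℕ) : (‖z‖ / η) ^ n ≤ |C| * (‖v‖ + 2) / ‖ψ v‖ := by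
    rw [le_div_iff₀ (norm_pos_iff.2 hv), div_pow, div_mul_eq_mul_div, div_le_iff₀ (by positivity)]
    have h1 := hC _ (pow_smul_mem_of_smul_subset hD hvD n)
    rw [AddMonoidHom.map_pow_smul_of_map_smul hψ, norm_mul, norm_pow, norm_smul, norm_pow,
      Real.norm_of_nonneg hη0.le] at h1
    have h2 : 1 ≤ η ^ n := one_le_pow₀ hη.le
    calc ‖z‖ ^ n * ‖ψ v‖ ≤ C * (η ^ n * ‖v‖ + 2) := h1
      _ ≤ |C| * (η ^ n * ‖v‖ + 2 * η ^ n) := by gcongr ?_ * (_ + ?_); exacts [le_abs_self C, by linarith]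
      _ = |C| * (‖v‖ + 2) * η ^ n := by ring
  obtain ⟨n, hn⟩ := pow_unbounded_of_one_lt (|C| * (‖v‖ + 2) / ‖ψ v‖) ((one_lt_div hη0).2 h)
  exact (hn.trans_le (hbound n)).false

end General

/-! ### Meyer sets: quasi-additivity. -/

section Meyer

/-- A chain of steps of size at most `c` in a finite set spans a distance at most `c` times the
cardinality of the set. -/
theorem norm_sub_le_card_mul_of_reflTransGen {V F : Type*} [Fintype V] [SeminormedAddCommGroup F]
    (f : V → F) {c : ℝ} (hc : 0 ≤ c) {a b : V}
    (h : Relation.ReflTransGen (fun a b => ‖f a - f b‖ ≤ c) a b) :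
    ‖f a - f b‖ ≤ Fintype.card V * c := by
  classical
  let G : SimpleGraph V := SimpleGraph.fromRel fun a b => ‖f a - f b‖ ≤ c
  have hadj {u v : V} (huv : G.Adj u v) : ‖f u - f v‖ ≤ c := by
    rcases huv.2 with h | h
    · exact h
    · rwa [norm_sub_rev]
  have hwalk {u v : V} (p : G.Walk u v) : ‖f u - f v‖ ≤ p.length * c := by
    induction p with
    | nil => simp
    | cons h p ih =>
      rw [SimpleGraph.Walk.length_cons]
      push_cast
      linarith [hadj h, norm_sub_le_norm_sub_add_norm_sub (f _) (f _) (f _) |>.trans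
        (add_le_add (hadj h) ih)]
  have hreach : G.Reachable a b := by
    induction h with
    | refl => exact .refl _
    | @tail u v _ huv ih =>
      by_cases h : u = v
      · rwa [← h]
      · exact ih.trans (SimpleGraph.Adj.reachable ⟨h, .inl huv⟩)
  obtain ⟨p⟩ := hreach
  -- Removing repeated vertices makes the bound independent of the length of the chain.
  refine (hwalk p.bypass).trans (mul_le_mul_of_nonneg_right ?_ hc)
  exact_mod_cast p.bypass_isPath.length_lt.le

variable {E : Type*} [NormedAddCommGroup E]

/-- A uniformly discrete set meets all balls of a given radius in boundedly many points. -/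
theorem exists_ncard_inter_closedBall_le [ProperSpace E] {D : Set E} {r : ℝ} (hr : 0 < r)
    (hD : ∀ x ∈ D, ∀ y ∈ D, dist x y < r → x = y) (T : ℝ) :
    ∃ N : ℕ, ∀ p, (D ∩ Metric.closedBall p T).Finite ∧ (D ∩ Metric.closedBall p T).ncard ≤ N := by
  obtain ⟨t, -, htf, ht⟩ := (isCompact_closedBall (0 : E) T).finite_cover_balls (half_pos hr)
  refine ⟨t.ncard, fun p => ?_⟩
  have hex : ∀ q ∈ D ∩ Metric.closedBall p T, ∃ y ∈ t, dist (q - p) y < r / 2 := by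
    rintro q ⟨-, hq⟩
    have : q - p ∈ Metric.closedBall (0 : E) T := by
      rwa [mem_closedBall_zero_iff, ← dist_eq_norm]
    simpa using ht this
  choose! f hft hf using hex
  have hinj : Set.InjOn f (D ∩ Metric.closedBall p T) := by
    intro a ha b hb hab
    refine hD a ha.1 b hb.1 ?_
    rw [← dist_sub_right a b p]
    have h1 := hf a ha
    have h2 := hf b hb
    rw [← hab] at h2
    linarith [dist_triangle_right (a - p) (b - p) (f a)]
  exact ⟨Set.Finite.of_injOn hft hinj htf, Set.ncard_le_ncard_of_injOn f hft hinj htf⟩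

theorem exists_norm_map_le_of_finite {D : Set E} (hD : ∀ T, (D ∩ Metric.closedBall 0 T).Finite)
    (ψ : E →+ ℂ) (T : ℝ) : ∃ C, ∀ x ∈ D, ‖x‖ ≤ T → ‖ψ x‖ ≤ C := by
  obtain ⟨C, hC⟩ := ((hD T).image fun x => ‖ψ x‖).bddAbove
  exact ⟨C, fun x hx hxT => hC ⟨x, ⟨hx, by simpa using hxT⟩, rfl⟩⟩

variable [NormedSpace ℝ E]

/-- On the difference set of a Meyer set, additive functions are uniformly bounded on pairs of
nearby points. -/
theorem exists_norm_map_sub_map_le_of_dist_le [ProperSpace E] {S : Set E} {R r : ℝ}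
    (hS : ∀ x, ∃ y ∈ S, dist x y ≤ R) (hr : 0 < r)
    (hD : ∀ x ∈ S - S, ∀ y ∈ S - S, dist x y < r → x = y) (ψ : E →+ ℂ) (T : ℝ) :
    ∃ C, ∀ p ∈ S - S, ∀ q ∈ S - S, dist p q ≤ T → ‖ψ p - ψ q‖ ≤ C := by
  have hR : 0 ≤ R := by
    obtain ⟨q, -, hq⟩ := hS 0
    exact dist_nonneg.trans hq
  obtain ⟨N, hN⟩ := exists_ncard_inter_closedBall_le hr hD R
  have hfin (T : ℝ) : ((S - S) ∩ Metric.closedBall 0 T).Finite :=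
    ((exists_ncard_inter_closedBall_le hr hD T).choose_spec 0).1
  obtain ⟨C₁, hC₁⟩ := exists_norm_map_le_of_finite hfin ψ (4 * R + 1)
  obtain ⟨C₂, hC₂⟩ := exists_norm_map_le_of_finite hfin ψ (R + T)
  refine ⟨N * (C₁ + C₁) + C₂, ?_⟩
  rintro p ⟨x, hx, y, hy, rfl⟩ q ⟨z, hz, w, hw, rfl⟩ hpq
  simp only at hpq ⊢
  have hC₁0 : 0 ≤ C₁ := by simpa using hC₁ 0 ⟨x, hx, x, hx, by simp⟩ (by simp; linarith)
  set A := (S - S) ∩ Metric.closedBall (x - y) R with hA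
  let a : A := ⟨x - y, Set.sub_mem_sub hx hy, by simpa⟩
  let f : A → ℂ := fun a => ψ a
  -- Slide the base point from `y` to `w` by short steps, carrying an approximate copy of `x - y`.
  -- The differences met all lie in `A`, and consecutive ones change `ψ` by at most `2 * C₁`; as `A`
  -- has at most `N` points, the total change does not depend on how far `w` is from `y`.
  have key : ∀ w, Relation.ReflTransGen (fun a b => b ∈ S ∧ dist a b ≤ 2 * R + 1) y w →
      w ∈ S ∧ ∃ x' ∈ S, ∃ b : A, (b : E) = x' - w ∧
        Relation.ReflTransGen (fun a b => ‖f a - f b‖ ≤ C₁ + C₁) a b := by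
    intro w h
    induction h with
    | refl => exact ⟨hy, x, hx, a, rfl, .refl⟩
    | @tail u v _ huv ih =>
      obtain ⟨hu, x', hx', b, hb, hab⟩ := ih
      refine ⟨huv.1, ?_⟩
      obtain ⟨x'', hx'', hd⟩ := hS (v + (x - y))
      have hmem : x'' - v ∈ A := by
        refine ⟨Set.sub_mem_sub hx'' huv.1, ?_⟩
        rw [Metric.mem_closedBall, dist_comm]
        calc dist (x - y) (x'' - v) = dist (v + (x - y)) x'' := by
              rw [dist_eq_norm, dist_eq_norm]; congr 1; abel
          _ ≤ R := hd
      refine ⟨x'', hx'', ⟨x'' - v, hmem⟩, rfl, hab.tail ?_⟩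
      have hb2 : ‖x' - u - (x - y)‖ ≤ R := by
        rw [← hb, ← dist_eq_norm]
        exact b.2.2
      have hd2 : ‖x - y - (x'' - v)‖ ≤ R := by
        rw [← dist_eq_norm, dist_comm]
        exact hmem.2
      have huv2 : ‖u - v‖ ≤ 2 * R + 1 := by
        rw [← dist_eq_norm]
        exact huv.2
      have h1 : ‖x' - x''‖ ≤ 4 * R + 1 := by
        have : x' - x'' = (x' - u - (x - y)) + (x - y - (x'' - v)) + (u - v) := by abel
        rw [this]
        linarith [norm_add₃_le (a := x' - u - (x - y)) (b := x - y - (x'' - v)) (c := u - v)]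
      have h2 : f b - f ⟨x'' - v, hmem⟩ = ψ (x' - x'') - ψ (u - v) := by
        simp only [f, hb, map_sub]
        abel
      rw [h2]
      exact (norm_sub_le _ _).trans (add_le_add (hC₁ _ (Set.sub_mem_sub hx' hx'') h1)
        (hC₁ _ (Set.sub_mem_sub hu huv.1) (by linarith)))
  obtain ⟨-, x', hx', b, hb, hab⟩ := key w (reflTransGen_of_relativelyDense hS hw hy)
  have : Fintype A := (hN (x - y)).1.fintype
  have h1 := norm_sub_le_card_mul_of_reflTransGen f (by linarith) hab
  have hcard : (Fintype.card A : ℝ) ≤ N := by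
    rw [← Nat.card_eq_fintype_card, Nat.card_coe_set_eq]
    exact_mod_cast (hN (x - y)).2
  have h2 : ‖ψ (x' - z)‖ ≤ C₂ := by
    refine hC₂ _ (Set.sub_mem_sub hx' hz) ?_
    have hb2 : ‖x' - w - (x - y)‖ ≤ R := by
      rw [← hb, ← dist_eq_norm]
      exact b.2.2
    rw [dist_eq_norm] at hpq
    have : x' - z = (x' - w - (x - y)) + (x - y - (z - w)) := by abel
    rw [this]
    exact (norm_add_le _ _).trans (add_le_add hb2 hpq)
  have h3 : ψ (x - y) - ψ (z - w) = (f a - f b) + ψ (x' - z) := by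
    simp only [f, a, hb, map_sub]
    abel
  rw [h3]
  refine (norm_add_le _ _).trans (add_le_add (h1.trans ?_) h2)
  gcongr

theorem le_of_forall_nat_mul_le {a b K : ℝ} (h : ∀ n : ℕ, n * a ≤ n * b + K) : a ≤ b := by
  by_contra! hab
  obtain ⟨n, hn⟩ := exists_nat_gt (K / (a - b))
  rw [div_lt_iff₀ (by linarith)] at hn
  linarith [h n]

/-- A quasi-additive function, bounded on segments from the origin, is quasi-homogeneous. -/
theorem norm_map_smul_sub_smul_map_le {F : Type*} [NormedAddCommGroup F] [NormedSpace ℝ F]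
    {g : E → F} {C η : ℝ} (hη : 0 ≤ η) (hg0 : ‖g 0‖ ≤ C)
    (hg : ∀ s t, ‖g (s + t) - g s - g t‖ ≤ C)
    (hb : ∀ t, ∃ K, ∀ a : ℝ, 0 ≤ a → a ≤ 1 → ‖g (a • t)‖ ≤ K) (t : E) :
    ‖g (η • t) - η • g t‖ ≤ (1 + η) * C := by
  have hC : 0 ≤ C := (norm_nonneg _).trans hg0
  have hnat (n : ℕ) (t : E) : ‖g ((n : ℝ) • t) - (n : ℝ) • g t‖ ≤ (n + 1) * C := by
    induction n with
    | zero => simpa using hg0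
    | succ n ih =>
      have h1 := hg ((n : ℝ) • t) t
      have h2 : g (((n + 1 : ℕ) : ℝ) • t) - ((n + 1 : ℕ) : ℝ) • g t =
          (g ((n : ℝ) • t + t) - g ((n : ℝ) • t) - g t) + (g ((n : ℝ) • t) - (n : ℝ) • g t) := by
        push_cast
        rw [add_smul, add_smul, one_smul, one_smul]
        abel
      rw [h2]
      push_cast
      linarith [norm_add_le (g ((n : ℝ) • t + t) - g ((n : ℝ) • t) - g t)
        (g ((n : ℝ) • t) - (n : ℝ) • g t)]
  obtain ⟨K, hK⟩ := hb t
  refine le_of_forall_nat_mul_le (K := 3 * C + K + ‖g t‖) fun n => ?_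
  -- Compare `g (n η t)` with `n g (η t)` and with `m g t`. The bound `K` and the rounding error
  -- depend on `t` but not on `n`, so they disappear after division by `n`.
  set m := ⌊n * η⌋₊ with hm
  have hm1 : (m : ℝ) ≤ n * η := Nat.floor_le (by positivity)
  have hm2 : n * η < m + 1 := Nat.lt_floor_add_one _
  have e1 := hnat n (η • t)
  have e2 := hnat m t
  have e3 := hg ((m : ℝ) • t) ((n * η - m) • t)
  have e4 := hK (n * η - m) (by linarith) (by linarith)
  rw [← add_smul, add_sub_cancel, mul_smul] at e3
  have e5 : ‖(m - n * η : ℝ) • g t‖ ≤ ‖g t‖ := by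
    rw [norm_smul]
    refine mul_le_of_le_one_left (norm_nonneg _) ?_
    rw [Real.norm_eq_abs, abs_le]
    constructor <;> linarith
  have e6 : (n : ℝ) • (g (η • t) - η • g t) =
      -(g ((n : ℝ) • η • t) - (n : ℝ) • g (η • t)) + (g ((m : ℝ) • t) - (m : ℝ) • g t) +
      (g ((n : ℝ) • η • t) - g ((m : ℝ) • t) - g ((n * η - m) • t)) + g ((n * η - m) • t) +
      (m - n * η : ℝ) • g t := by
    module
  have e7 : n * ‖g (η • t) - η • g t‖ = ‖(n : ℝ) • (g (η • t) - η • g t)‖ := by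
    rw [norm_smul]; simp
  rw [e7, e6]
  refine (norm_add_le _ _).trans ?_
  grw [norm_add_le, norm_add₃_le, norm_neg, e1, e2, e3, e4, e5]
  nlinarith

/-- With `g t` the value of `ψ` at a difference near `t`, both `z * ψ p` and `η * ψ p` are within a
bounded distance of `g (η • p)`. Hence `‖z - η‖ * ‖ψ p‖` is bounded on `S - S`, and so are the
powers of `‖z‖`. -/
theorem norm_le_one_of_meyer [ProperSpace E] {S : Set E} {R r η : ℝ}
    (hS : ∀ x, ∃ y ∈ S, dist x y ≤ R) (hr : 0 < r)
    (hD : ∀ x ∈ S - S, ∀ y ∈ S - S, dist x y < r → x = y)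
    (hη : 1 < η) (hηD : ∀ x ∈ S - S, η • x ∈ S - S) {z : ℂ} (hzη : z ≠ η) {ψ : E →+ ℂ}
    (hψ : ∀ x, ψ (η • x) = z * ψ x) {v : E} (hvD : v ∈ S - S) (hv : ψ v ≠ 0) : ‖z‖ ≤ 1 := by
  have hR : 0 ≤ R := by
    obtain ⟨q, -, hq⟩ := hS 0
    exact dist_nonneg.trans hq
  obtain ⟨C, hC⟩ := exists_norm_map_sub_map_le_of_dist_le hS hr hD ψ (3 * R)
  obtain ⟨x₀, hx₀, -⟩ := hS 0
  have hzero : (0 : E) ∈ S - S := ⟨x₀, hx₀, x₀, hx₀, by simp⟩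
  choose q hqS hq using fun t => hS (x₀ + t)
  have hqD (t : E) : q t - x₀ ∈ S - S := Set.sub_mem_sub (hqS t) hx₀
  have hqd (t : E) : ‖t - (q t - x₀)‖ ≤ R := by
    have := hq t
    rw [dist_eq_norm] at this
    rwa [sub_sub_eq_add_sub, add_comm]
  let g : E → ℂ := fun t => ψ (q t - x₀)
  have hψg {p : E} (hp : p ∈ S - S) : ‖ψ p - g p‖ ≤ C :=
    hC p hp _ (hqD p) (by rw [dist_eq_norm]; linarith [hqd p])
  have hg0 : ‖g 0‖ ≤ C := by simpa using hψg hzero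
  have hadd (s t : E) : ‖g (s + t) - g s - g t‖ ≤ C := by
    -- Changing the base point from `x₀` to `q t` gives another difference near `s`; three rounding
    -- errors account for `3 * R`.
    have h1 := hC (q (s + t) - q t) (Set.sub_mem_sub (hqS _) (hqS _)) _ (hqD s) (by
      rw [dist_eq_norm]
      have : q (s + t) - q t - (q s - x₀) = -(s + t - (q (s + t) - x₀)) + (t - (q t - x₀)) +
        (s - (q s - x₀)) := by abel
      rw [this]
      grw [norm_add₃_le, norm_neg, hqd, hqd, hqd]
      linarith)
    convert h1 using 2
    simp only [g, map_sub]
    abel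
  have hseg (t : E) : ∃ K, ∀ a : ℝ, 0 ≤ a → a ≤ 1 → ‖g (a • t)‖ ≤ K := by
    obtain ⟨K, hK⟩ := exists_norm_map_sub_map_le_of_dist_le hS hr hD ψ (R + ‖t‖)
    refine ⟨K, fun a ha0 ha1 => ?_⟩
    have := hK _ (hqD (a • t)) 0 hzero (by
      rw [dist_zero_right]
      have h2 : ‖a • t‖ ≤ ‖t‖ := by
        rw [norm_smul, Real.norm_of_nonneg ha0]
        exact mul_le_of_le_one_left (norm_nonneg _) ha1
      have h3 : q (a • t) - x₀ = a • t - (a • t - (q (a • t) - x₀)) := by abel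
      rw [h3]
      grw [norm_sub_le, hqd, h2]
      linarith)
    simpa only [map_zero, sub_zero] using this
  have hη0 : 0 ≤ η := by linarith
  have hquasi := norm_map_smul_sub_smul_map_le hη0 hg0 hadd hseg
  have hzη' : 0 < ‖z - η‖ := norm_pos_iff.2 (sub_ne_zero.2 hzη)
  have hbdd {p : E} (hp : p ∈ S - S) : ‖ψ p‖ ≤ (2 + 2 * η) * C / ‖z - η‖ := by
    rw [le_div_iff₀ hzη', ← norm_mul]
    have h1 : ψ p * (z - η) = (ψ (η • p) - g (η • p)) + (g (η • p) - η • g p) -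
        η • (ψ p - g p) := by
      rw [hψ, smul_sub]
      simp only [Complex.real_smul]
      ring
    rw [h1]
    grw [norm_sub_le, norm_add_le, norm_smul, hψg hp, hψg (hηD p hp), hquasi,
      Real.norm_of_nonneg hη0]
    linarith
  by_contra! hz
  obtain ⟨n, hn⟩ := pow_unbounded_of_one_lt ((2 + 2 * η) * C / ‖z - η‖ / ‖ψ v‖) hz
  rw [div_lt_iff₀ (norm_pos_iff.2 hv)] at hn
  have h := hbdd (pow_smul_mem_of_smul_subset hηD hvD n)
  rw [AddMonoidHom.map_pow_smul_of_map_smul hψ, norm_mul, norm_pow] at h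
  exact (hn.trans_le h).false

end Meyer

/-! ### Repetitive sets: excluding the extremal growth rate. -/

section Repetitive

open Filter Topology

variable {E : Type*} [NormedAddCommGroup E] [InnerProductSpace ℝ E]

/-- By Pythagoras, a sideways deviation of at most `2 * M` lengthens a vector only quadratically,
divided by its extent along `u`, which is at least `P - 2 * M`. -/
theorem norm_le_inner_add_of_norm_sub_smul_le {u g : E} {P M : ℝ} (hu : ‖u‖ = 1)
    (hP : 2 * M < P) (hg : ‖g - P • u‖ ≤ 2 * M) :
    ‖g‖ ≤ inner ℝ u g + 2 * M ^ 2 / (P - 2 * M) := by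
  have hPM : 0 < P - 2 * M := by linarith
  set A := inner ℝ u g with hA
  have h1 : ‖g - P • u‖ ^ 2 = ‖g‖ ^ 2 - 2 * P * A + P ^ 2 := by
    rw [norm_sub_sq_real, inner_smul_right, norm_smul, hu, real_inner_comm, ← hA, mul_one,
      Real.norm_eq_abs, sq_abs]
    ring
  have h2 : |A - P| ≤ 2 * M := by
    have h3 : A - P = inner ℝ u (g - P • u) := by
      rw [inner_sub_right, inner_smul_right, real_inner_self_eq_norm_sq, hu]
      simp [hA]
    rw [h3]
    exact (abs_real_inner_le_norm _ _).trans (by rw [hu, one_mul]; exact hg)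
  have h4 : P - 2 * M ≤ A := by linarith [(abs_le.1 h2).1]
  have h5 : ‖g - P • u‖ ^ 2 ≤ (2 * M) ^ 2 := pow_le_pow_left₀ (norm_nonneg _) hg 2
  have h6 : 2 * M ^ 2 ≤ 2 * M ^ 2 / (P - 2 * M) * A := by
    rw [div_mul_eq_mul_div, le_div_iff₀ hPM]
    nlinarith [sq_nonneg M]
  refine le_of_sq_le_sq ?_
    (add_nonneg (hPM.le.trans h4) (div_nonneg (by positivity) hPM.le))
  nlinarith [sq_nonneg (A - P), sq_nonneg (2 * M ^ 2 / (P - 2 * M))]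

/-- The ratios `‖ψ x‖ / ‖x‖` have a least upper bound on `D` approached along a sequence going to
infinity whose directions, and the directions of whose images, converge. -/
theorem exists_extremal_sequence [ProperSpace E] {D : Set E} {η C ρ : ℝ} {z : ℂ} {ψ : E →+ ℂ}
    (hη : 1 < η) (hz : ‖z‖ = η) (hψ : ∀ x, ψ (η • x) = z * ψ x) (hηD : ∀ x ∈ D, η • x ∈ D)
    (hC : ∀ x ∈ D, ‖ψ x‖ ≤ C * (‖x‖ + 2)) (hρ : 0 < ρ) (hDρ : ∀ x ∈ D, x ≠ 0 → ρ ≤ ‖x‖)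
    {v : E} (hvD : v ∈ D) (hv : ψ v ≠ 0) :
    ∃ (c : ℝ) (d : ℕ → E) (u : E) (w : ℂ), 0 < c ∧ (∀ x ∈ D, ‖ψ x‖ ≤ c * ‖x‖) ∧
      (∀ n, d n ∈ D) ∧ Tendsto (fun n => ‖d n‖) atTop atTop ∧ ‖u‖ = 1 ∧ ‖w‖ = c ∧
      Tendsto (fun n => ‖d n‖⁻¹ • d n) atTop (𝓝 u) ∧
      Tendsto (fun n => ‖d n‖⁻¹ • ψ (d n)) atTop (𝓝 w) := by
  have hη0 : 0 < η := by linarith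
  have hne {x : E} (hx : ψ x ≠ 0) : x ≠ 0 := by
    rintro rfl
    exact hx (map_zero ψ)
  have hbdd : BddAbove ((fun x => ‖ψ x‖ / ‖x‖) '' D) := by
    refine ⟨|C| * (1 + 2 / ρ), ?_⟩
    rintro _ ⟨x, hx, rfl⟩
    by_cases h : x = 0
    · simp only [h, norm_zero, div_zero]
      positivity
    · simp only
      have hx0 : 0 < ‖x‖ := norm_pos_iff.2 h
      rw [div_le_iff₀ hx0]
      have h2 : 2 ≤ 2 / ρ * ‖x‖ := by
        rw [div_mul_eq_mul_div, le_div_iff₀ hρ]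
        linarith [hDρ x hx h]
      calc ‖ψ x‖ ≤ C * (‖x‖ + 2) := hC x hx
        _ ≤ |C| * (‖x‖ + 2 / ρ * ‖x‖) :=
          mul_le_mul (le_abs_self C) (by linarith) (by positivity) (abs_nonneg C)
        _ = |C| * (1 + 2 / ρ) * ‖x‖ := by ring
  set c := sSup ((fun x => ‖ψ x‖ / ‖x‖) '' D) with hc
  have hle (x : E) (hx : x ∈ D) : ‖ψ x‖ / ‖x‖ ≤ c := le_csSup hbdd ⟨x, hx, rfl⟩
  have hc0 : 0 < c :=
    (div_pos (norm_pos_iff.2 hv) (norm_pos_iff.2 (hne hv))).trans_le (hle v hvD)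
  have hle' (x : E) (hx : x ∈ D) : ‖ψ x‖ ≤ c * ‖x‖ := by
    by_cases h : x = 0
    · simp [h]
    · exact (div_le_iff₀ (norm_pos_iff.2 h)).1 (hle x hx)
  have hex (n : ℕ) : ∃ x ∈ D, (n : ℝ) ≤ ‖x‖ ∧ x ≠ 0 ∧ c - 1 / ((n : ℝ) + 1) ≤ ‖ψ x‖ / ‖x‖ := by
    -- The maximum with `0` excludes `x = 0`, whose ratio is `0` by the convention for division.
    have hlt : max (c - 1 / ((n : ℝ) + 1)) 0 < c :=
      max_lt (sub_lt_self c Nat.one_div_pos_of_nat) hc0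
    obtain ⟨_, ⟨x, hx, rfl⟩, hxc⟩ := exists_lt_of_lt_csSup (Set.Nonempty.image _ ⟨v, hvD⟩) hlt
    simp only at hxc
    have hx0 : x ≠ 0 := by
      rintro rfl
      simp at hxc
    have hx0' : 0 < ‖x‖ := norm_pos_iff.2 hx0
    -- Since `‖z‖ = η`, scaling by `η ^ k` keeps the ratio and pushes near-maximizers to infinity.
    obtain ⟨k, hk⟩ := pow_unbounded_of_one_lt (n / ‖x‖) hη
    have hk0 : 0 < η ^ k := by positivity
    have hnorm : ‖η ^ k • x‖ = η ^ k * ‖x‖ := by rw [norm_smul, Real.norm_of_nonneg hk0.le]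
    refine ⟨η ^ k • x, pow_smul_mem_of_smul_subset hηD hx k, ?_, smul_ne_zero hk0.ne' hx0, ?_⟩
    · rw [hnorm]
      exact ((div_lt_iff₀ hx0').1 hk).le
    · rw [hnorm, AddMonoidHom.map_pow_smul_of_map_smul hψ, norm_mul, norm_pow, hz,
        mul_div_mul_left _ _ hk0.ne']
      exact (le_max_left _ _).trans hxc.le
  choose d hdD hdn hd0 hdc using hex
  have hd0' (n : ℕ) : 0 < ‖d n‖ := norm_pos_iff.2 (hd0 n)
  have hratio (n : ℕ) : ‖‖d n‖⁻¹ • ψ (d n)‖ = ‖ψ (d n)‖ / ‖d n‖ := by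
    rw [norm_smul, norm_inv, norm_norm, inv_mul_eq_div]
  have hunit (n : ℕ) : ‖‖d n‖⁻¹ • d n‖ = 1 := by
    rw [norm_smul, norm_inv, norm_norm, inv_mul_cancel₀ (hd0' n).ne']
  have hcpt : IsCompact (Metric.closedBall (0 : E) 1 ×ˢ Metric.closedBall (0 : ℂ) c) :=
    (isCompact_closedBall _ _).prod (isCompact_closedBall _ _)
  obtain ⟨⟨u, w⟩, -, φ, hφ, hlim⟩ := hcpt.tendsto_subseq
    (x := fun n => (‖d n‖⁻¹ • d n, ‖d n‖⁻¹ • ψ (d n))) (fun n => by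
      refine ⟨?_, ?_⟩
      · simpa only [mem_closedBall_zero_iff] using (hunit n).le
      · simpa only [mem_closedBall_zero_iff, hratio] using hle _ (hdD n))
  have hlu : Tendsto (fun n => ‖d (φ n)‖⁻¹ • d (φ n)) atTop (𝓝 u) :=
    (continuous_fst.tendsto _).comp hlim
  have hlw : Tendsto (fun n => ‖d (φ n)‖⁻¹ • ψ (d (φ n))) atTop (𝓝 w) :=
    (continuous_snd.tendsto _).comp hlim
  refine ⟨c, d ∘ φ, u, w, hc0, hle', fun n => hdD _, ?_, ?_, ?_, hlu, hlw⟩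
  · exact (tendsto_atTop_mono hdn tendsto_natCast_atTop_atTop).comp hφ.tendsto_atTop
  · refine tendsto_nhds_unique hlu.norm ?_
    simp only [hunit]
    exact tendsto_const_nhds
  · refine tendsto_nhds_unique hlw.norm ?_
    have h1 : Tendsto (fun n => ‖‖d n‖⁻¹ • ψ (d n)‖) atTop (𝓝 c) := by
      refine tendsto_of_tendsto_of_tendsto_of_le_of_le
        (g := fun n : ℕ => c - 1 / ((n : ℝ) + 1)) ?_ tendsto_const_nhds
        (fun n => ?_) (fun n => ?_)
      · simpa using tendsto_const_nhds (x := c).sub tendsto_one_div_add_atTop_nhds_zero_nat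
      · simpa only [hratio] using hdc n
      · simpa only [hratio] using hle _ (hdD n)
    exact h1.comp hφ.tendsto_atTop

/-- If a translate of every pair of points of a relatively dense set occurs in all large enough
balls, no additive function grows at the extremal rate with a rotating phase. -/
theorem norm_ne_of_repetitive [ProperSpace E] {S : Set E} {η C ρ : ℝ} {z : ℂ} {ψ : E →+ ℂ}
    (hη : 1 < η) (hzη : z ≠ η) (hψ : ∀ x, ψ (η • x) = z * ψ x)
    (hηD : ∀ x ∈ S - S, η • x ∈ S - S)
    (hC : ∀ x ∈ S - S, ‖ψ x‖ ≤ C * (‖x‖ + 2)) (hρ : 0 < ρ)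
    (hDρ : ∀ x ∈ S - S, x ≠ 0 → ρ ≤ ‖x‖) {v : E} (hvD : v ∈ S - S) (hv : ψ v ≠ 0)
    (hrep : ∀ v ∈ S - S, ∃ M : ℝ, 0 < M ∧
      ∀ c, ∃ s ∈ S, s + v ∈ S ∧ dist s c ≤ M ∧ dist (s + v) c ≤ M) : ‖z‖ ≠ η := by
  intro hz
  obtain ⟨c, d, u, w, hc, hle, hdD, hdtop, hu, hw, hdu, hdw⟩ :=
    exists_extremal_sequence hη hz hψ hηD hC hρ hDρ hvD hv
  -- `H` is additive, and on `S - S` it is at least `c ^ 2 * (inner ℝ u x - ‖x‖)`: a difference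
  -- pointing nearly along `u` cannot lower it much.
  let H : E → ℝ := fun x => c ^ 2 * inner ℝ u x - inner ℝ w (ψ x)
  have hHadd (x y : E) : H (x + y) = H x + H y := by
    simp only [H, map_add, inner_add_right]
    ring
  have hL {x : E} (hx : x ∈ S - S) : inner ℝ w (ψ x) ≤ c ^ 2 * ‖x‖ := by
    refine (real_inner_le_norm _ _).trans ?_
    rw [hw, pow_two, mul_assoc]
    exact mul_le_mul_of_nonneg_left (hle x hx) hc.le
  have hHlow {x : E} (hx : x ∈ S - S) : -(2 * c ^ 2 * ‖x‖) ≤ H x := by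
    have h1 := abs_real_inner_le_norm u x
    rw [hu, one_mul] at h1
    have h2 : c ^ 2 * -‖x‖ ≤ c ^ 2 * inner ℝ u x :=
      mul_le_mul_of_nonneg_left (abs_le.1 h1).1 (by positivity)
    simp only [H]
    linarith [hL hx]
  have hHlim (a : ℂ) (t : ℝ) : Tendsto
      (fun n => c ^ 2 * (t * inner ℝ u (‖d n‖⁻¹ • d n)) - inner ℝ w (a * (‖d n‖⁻¹ • ψ (d n))))
      atTop (𝓝 (c ^ 2 * (t - a.re))) := by
    have h1 : Tendsto (fun n => inner ℝ u (‖d n‖⁻¹ • d n)) atTop (𝓝 (inner ℝ u u)) :=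
      tendsto_const_nhds.inner hdu
    have h2 : Tendsto (fun n => inner ℝ w (a * (‖d n‖⁻¹ • ψ (d n)))) atTop
        (𝓝 (inner ℝ w (a * w))) := tendsto_const_nhds.inner (hdw.const_mul a)
    have h3 : inner ℝ w (a * w) = c ^ 2 * a.re := by
      rw [Complex.inner, mul_assoc, Complex.mul_conj, ← hw, Complex.normSq_eq_norm_sq,
        Complex.re_mul_ofReal, mul_comm]
    rw [h3] at h2
    rw [real_inner_self_eq_norm_sq, hu] at h1
    convert ((h1.const_mul t).const_mul (c ^ 2)).sub h2 using 2
    ring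
  have hH0 : Tendsto (fun n => ‖d n‖⁻¹ * H (d n)) atTop (𝓝 0) := by
    convert hHlim 1 1 using 2
    · simp only [H, inner_smul_right, one_mul]
      ring
    · simp
  have hre : z.re < η := by
    refine lt_of_le_of_ne ((Complex.re_le_norm z).trans hz.le) fun h => hzη ?_
    have h1 := Complex.re_eq_norm.1 (h.trans hz.symm)
    apply Complex.ext
    · simp [h]
    · simp [← (Complex.le_def.1 h1).2]
  -- Along `η • d n`, the phase of `ψ` is turned by `z` while the direction stays near `u`, so the
  -- normalized `H` tends to `c ^ 2 * (η - z.re)`.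
  obtain ⟨v₁, hv₁D, hΛ⟩ : ∃ v₁ ∈ S - S, 0 < H v₁ := by
    have h1 : 0 < c ^ 2 * (η - z.re) := mul_pos (by positivity) (by linarith)
    obtain ⟨n, hn, hn0⟩ := (((hHlim z η).eventually_const_lt h1).and
      (hdtop.eventually_gt_atTop 0)).exists
    refine ⟨η • d n, hηD _ (hdD n), ?_⟩
    have h2 : c ^ 2 * (η * inner ℝ u (‖d n‖⁻¹ • d n)) - inner ℝ w (z * (‖d n‖⁻¹ • ψ (d n))) =
        ‖d n‖⁻¹ * H (η • d n) := by
      simp only [H, hψ, mul_smul_comm, inner_smul_right]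
      ring
    rw [h2] at hn
    exact pos_of_mul_pos_right hn (by positivity)
  set Λ := H v₁ with hΛdef
  obtain ⟨M, hM, hM'⟩ := hrep v₁ hv₁D
  -- Steps this long make the loss in `H` on each connecting step at most `Λ / 2`, half the gain
  -- from a copy of `v₁`.
  set P := 2 * M + 4 * M ^ 2 * c ^ 2 / Λ + 1 with hPdef
  have hfrac : 0 < 4 * M ^ 2 * c ^ 2 / Λ := by positivity
  have hP : 2 * M < P := by linarith
  have hP0 : 0 < P := by linarith
  have hPε : c ^ 2 * (2 * M ^ 2 / (P - 2 * M)) ≤ Λ / 2 := by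
    have h1 : 0 < P - 2 * M := by linarith
    have h2 : 4 * M ^ 2 * c ^ 2 / Λ ≤ P - 2 * M := by linarith
    rw [div_le_iff₀ hΛ] at h2
    rw [← mul_div_assoc, div_le_iff₀ h1]
    linarith
  have hpath (a : E) (ha : a ∈ S) (k : ℕ) :
      ∃ s ∈ S, dist s (a + (k * P) • u) ≤ M ∧ k * (Λ / 2) ≤ H (s - a) := by
    induction k with
    | zero => exact ⟨a, ha, by simp [hM.le], by simp [H]⟩
    | succ k ih =>
      obtain ⟨s', hs', hd', hH'⟩ := ih
      obtain ⟨s, hs, hsv, hd1, hd2⟩ := hM' (a + ((k + 1 : ℕ) * P) • u)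
      refine ⟨s + v₁, hsv, hd2, ?_⟩
      have hg : ‖s - s' - P • u‖ ≤ 2 * M := by
        rw [dist_eq_norm] at hd1 hd'
        have h1 : s - s' - P • u = (s - (a + ((k + 1 : ℕ) * P) • u)) -
            (s' - (a + (k * P) • u)) := by
          push_cast
          module
        rw [h1]
        linarith [norm_sub_le (s - (a + ((k + 1 : ℕ) * P) • u)) (s' - (a + (k * P) • u))]
      have h2 := norm_le_inner_add_of_norm_sub_smul_le hu hP hg
      have h3 := mul_le_mul_of_nonneg_left h2 (sq_nonneg c)
      have h4 := hL (Set.sub_mem_sub hs hs')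
      have h5 : -(Λ / 2) ≤ H (s - s') := by
        simp only [H]
        linarith
      have h6 : H (s + v₁ - a) = H (s' - a) + H (s - s') + Λ := by
        rw [hΛdef, ← hHadd, ← hHadd]
        congr 1
        abel
      rw [h6]
      push_cast
      linarith
  have hlow (n : ℕ) : (‖d n‖ / P - 1) * (Λ / 2) - 2 * c ^ 2 * (‖d n - ‖d n‖ • u‖ + P + M) ≤
      H (d n) := by
    obtain ⟨b, hb, a, ha, hba⟩ := hdD n
    simp only at hba
    -- After `k` steps from `a` the path ends near `b`; the remainder `b - s` is sublinear in `‖d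
    -- n‖` because the directions converge to `u`.
    set k := ⌊‖d n‖ / P⌋₊ with hk
    have hk1 : (k : ℝ) ≤ ‖d n‖ / P := Nat.floor_le (by positivity)
    have hk2 : ‖d n‖ / P < k + 1 := Nat.lt_floor_add_one _
    obtain ⟨s, hs, hsd, hsH⟩ := hpath a ha k
    have h1 : H (d n) = H (s - a) + H (b - s) := by
      rw [← hHadd, ← hba]
      congr 1
      abel
    have h2 := hHlow (Set.sub_mem_sub hb hs)
    have h3 : ‖(‖d n‖ - k * P) • u‖ ≤ P := by
      rw [le_div_iff₀ hP0] at hk1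
      rw [div_lt_iff₀ hP0] at hk2
      rw [norm_smul, hu, mul_one, Real.norm_of_nonneg (by linarith)]
      linarith
    have h4 : ‖b - s‖ ≤ ‖d n - ‖d n‖ • u‖ + P + M := by
      have h5 : b - s = (d n - ‖d n‖ • u) + (‖d n‖ - k * P) • u - (s - (a + (k * P) • u)) := by
        rw [sub_smul, ← hba]
        abel
      rw [h5]
      rw [dist_eq_norm] at hsd
      grw [norm_sub_le, norm_add_le, h3, hsd]
    have h6 : 2 * c ^ 2 * ‖b - s‖ ≤ 2 * c ^ 2 * (‖d n - ‖d n‖ • u‖ + P + M) := by gcongr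
    have h7 : (‖d n‖ / P - 1) * (Λ / 2) ≤ k * (Λ / 2) := by
      gcongr
      linarith
    linarith
  have hinv : Tendsto (fun n => ‖d n‖⁻¹) atTop (𝓝 0) := tendsto_inv_atTop_zero.comp hdtop
  have hdu' : Tendsto (fun n => ‖‖d n‖⁻¹ • d n - u‖) atTop (𝓝 0) :=
    tendsto_iff_norm_sub_tendsto_zero.1 hdu
  have hlim : Tendsto (fun n => ‖d n‖⁻¹ * H (d n) + 2 * c ^ 2 * ‖‖d n‖⁻¹ • d n - u‖ +
      (Λ / 2 + 2 * c ^ 2 * (P + M)) * ‖d n‖⁻¹) atTop (𝓝 0) := by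
    simpa using (hH0.add (hdu'.const_mul (2 * c ^ 2))).add
      (hinv.const_mul (Λ / 2 + 2 * c ^ 2 * (P + M)))
  obtain ⟨n, hn, hn0⟩ := ((hlim.eventually_lt_const (show 0 < Λ / 2 / P by positivity)).and
    (hdtop.eventually_gt_atTop 0)).exists
  have h1 : ‖d n - ‖d n‖ • u‖ = ‖d n‖ * ‖‖d n‖⁻¹ • d n - u‖ := by
    rw [← norm_norm (d n), ← norm_smul, norm_norm, smul_sub, smul_inv_smul₀ hn0.ne']
  have h2 := hlow n
  rw [h1] at h2
  have h3 := mul_lt_mul_of_pos_left hn hn0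
  have h4 : ‖d n‖ * (‖d n‖⁻¹ * H (d n) + 2 * c ^ 2 * ‖‖d n‖⁻¹ • d n - u‖ +
      (Λ / 2 + 2 * c ^ 2 * (P + M)) * ‖d n‖⁻¹) = H (d n) +
      2 * c ^ 2 * (‖d n‖ * ‖‖d n‖⁻¹ • d n - u‖) + (Λ / 2 + 2 * c ^ 2 * (P + M)) := by
    field_simp
  have h5 : ‖d n‖ * (Λ / 2 / P) = ‖d n‖ / P * (Λ / 2) := by ring
  rw [h4, h5] at h3
  linarith

end Repetitive

/-! ### Application to Delone sets. -/

section Inflation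

variable {d : ℕ} {X : Delone.DeloneSet (Euc d)} {η : ℝ}

theorem smul_mem_sub_of_smul_subset {S : Set (Euc d)} (h : η • S ⊆ S) :
    ∀ x ∈ S - S, η • x ∈ S - S := by
  rintro _ ⟨x, hx, y, hy, rfl⟩
  exact ⟨η • x, h ⟨x, hx, rfl⟩, η • y, h ⟨y, hy, rfl⟩, (smul_sub η x y).symm⟩

theorem Delone.DeloneSet.exists_mem_sub_ne_zero (X : Delone.DeloneSet (Euc d)) (hd : 1 ≤ d) :
    ∃ v ∈ (X : Set (Euc d)) - (X : Set (Euc d)), v ≠ 0 := by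
  have : Nonempty (Fin d) := ⟨⟨0, hd⟩⟩
  obtain ⟨x, hx⟩ := X.nonempty
  obtain ⟨e, he⟩ := NormedSpace.exists_lt_norm ℝ (Euc d) X.coveringRadius
  obtain ⟨y, hy, hxy⟩ := X.exists_dist_le_coveringRadius (x + e)
  refine ⟨y - x, Set.sub_mem_sub hy hx, fun h => ?_⟩
  rw [sub_eq_zero.1 h, dist_eq_norm, add_sub_cancel_left] at hxy
  linarith

/-- The short differences generate the group and are finite in number. -/
theorem IsFiniteType.isFinitelyGenerated (h : IsFiniteType X) : IsFinitelyGenerated X := by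
  rw [IsFinitelyGenerated, closure_sub_eq_closure_short_sub X.exists_dist_le_coveringRadius]
  exact (AddSubgroup.fg_iff _).2 ⟨_, rfl, h 0 _⟩

theorem IsFiniteType.exists_norm_map_le (h : IsFiniteType X) (ψ : Euc d →+ ℂ) :
    ∃ C, ∀ x ∈ (X : Set (Euc d)) - (X : Set (Euc d)), ‖ψ x‖ ≤ C * (‖x‖ + 2) := by
  obtain ⟨C, hC⟩ := exists_norm_map_le_of_finite (h 0) ψ (2 * X.coveringRadius + 1)
  refine ⟨C, ?_⟩
  rintro _ ⟨x, hx, y, hy, rfl⟩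
  refine norm_map_sub_le_of_relativelyDense X.exists_dist_le_coveringRadius
    (fun x hx y hy hxy => hC _ (Set.sub_mem_sub hx hy) ?_) hx hy
  rwa [← dist_eq_norm]

theorem IsUniformlyDiscrete.exists_eq_of_dist_lt {S : Set (Euc d)} (h : IsUniformlyDiscrete S) :
    ∃ r : ℝ, 0 < r ∧ ∀ x ∈ S, ∀ y ∈ S, dist x y < r → x = y := by
  obtain ⟨r, hr, hS⟩ := h
  refine ⟨r, hr, fun x hx y hy hxy => ?_⟩
  by_contra hne
  have h1 : (r : ℝ≥0∞) < edist x y := hS hx hy hne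
  rw [edist_nndist, ENNReal.coe_lt_coe, ← NNReal.coe_lt_coe, coe_nndist] at h1
  exact (h1.trans hxy).false

theorem IsMeyer.isFiniteType (h : IsMeyer X) : IsFiniteType X := by
  obtain ⟨r, hr, hD⟩ := IsUniformlyDiscrete.exists_eq_of_dist_lt h
  exact fun c T => ((exists_ncard_inter_closedBall_le hr hD T).choose_spec c).1

theorem IsRepetitive.exists_dist_le (h : IsRepetitive X) {v : Euc d}
    (hv : v ∈ (X : Set (Euc d)) - (X : Set (Euc d))) :
    ∃ M : ℝ, 0 < M ∧ ∀ c, ∃ s ∈ (X : Set (Euc d)), s + v ∈ (X : Set (Euc d)) ∧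
      dist s c ≤ M ∧ dist (s + v) c ≤ M := by
  obtain ⟨x, hx, y, hy, rfl⟩ := hv
  -- The cluster around `y` then contains both points; the `+ 1` keeps the radius positive when `x =
  -- y`.
  obtain ⟨M, hM, hM'⟩ := h (dist x y + 1) (by positivity)
  refine ⟨M, hM, fun c => ?_⟩
  obtain ⟨t, ht, hsub⟩ := hM' y c
  have hmem {p : Euc d} (hp : p ∈ cluster X y (dist x y + 1)) :
      t + p ∈ cluster X (y + t) (dist x y + 1) := by
    rw [ht]
    exact ⟨p, hp, rfl⟩
  have hy' := hmem ⟨hy, by simp only [Metric.mem_closedBall, dist_self]; positivity⟩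
  have hx' := hmem ⟨hx, by simp⟩
  have heq : t + y + (x - y) = t + x := by abel
  refine ⟨t + y, hy'.1, ?_, hsub hy', ?_⟩
  · simpa only [heq] using hx'.1
  · simpa only [heq, Metric.mem_closedBall] using hsub hx'

theorem IsFinitelyGenerated.isIntegral (h : IsFinitelyGenerated X) (hd : 1 ≤ d)
    (hinfl : η • (X : Set (Euc d)) ⊆ (X : Set (Euc d))) : IsIntegral ℤ η := by
  obtain ⟨v, hvD, hv⟩ := X.exists_mem_sub_ne_zero hd
  exact isIntegral_of_closure_fg (smul_mem_sub_of_smul_subset hinfl) h hvD hv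

theorem IsFiniteType.isExpandingInteger (h : IsFiniteType X) (hd : 1 ≤ d) (hη : 1 < η)
    (hinfl : η • (X : Set (Euc d)) ⊆ (X : Set (Euc d))) : IsExpandingInteger η :=
  ⟨h.isFinitelyGenerated.isIntegral hd hinfl, hη⟩

theorem IsFiniteType.norm_le_of_mem_conjugates (h : IsFiniteType X) (hd : 1 ≤ d) (hη : 1 < η)
    (hinfl : η • (X : Set (Euc d)) ⊆ (X : Set (Euc d))) {z : ℂ} (hz : z ∈ conjugates η) :
    ‖z‖ ≤ η := by
  obtain ⟨v, hvD, hv⟩ := X.exists_mem_sub_ne_zero hd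
  obtain ⟨ψ, hψ, hψv⟩ := exists_addMonoidHom_smul_eq_mul
    (h.isExpandingInteger hd hη hinfl).1.tower_top hz.2 hv
  obtain ⟨C, hC⟩ := h.exists_norm_map_le ψ
  exact norm_le_of_norm_map_le hη hψ (smul_mem_sub_of_smul_subset hinfl) hC hvD hψv

theorem IsFiniteType.norm_ne_of_isRepetitive (h : IsFiniteType X) (hrep : IsRepetitive X)
    (hd : 1 ≤ d) (hη : 1 < η) (hinfl : η • (X : Set (Euc d)) ⊆ (X : Set (Euc d))) {z : ℂ}
    (hz : z ∈ conjugates η) : ‖z‖ ≠ η := by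
  obtain ⟨v, hvD, hv⟩ := X.exists_mem_sub_ne_zero hd
  obtain ⟨ψ, hψ, hψv⟩ := exists_addMonoidHom_smul_eq_mul
    (h.isExpandingInteger hd hη hinfl).1.tower_top hz.2 hv
  obtain ⟨C, hC⟩ := h.exists_norm_map_le ψ
  refine norm_ne_of_repetitive hη hz.1 hψ (smul_mem_sub_of_smul_subset hinfl) hC
    (ρ := X.packingRadius) X.packingRadius_pos ?_ hvD hψv fun _ => hrep.exists_dist_le
  rintro _ ⟨x, hx, y, hy, rfl⟩ hne
  rw [← dist_eq_norm]
  exact (X.packingRadius_lt_dist_of_mem_ne hx hy (sub_ne_zero.1 hne)).le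

theorem IsMeyer.norm_le_one_of_mem_conjugates (h : IsMeyer X) (hd : 1 ≤ d) (hη : 1 < η)
    (hinfl : η • (X : Set (Euc d)) ⊆ (X : Set (Euc d))) {z : ℂ} (hz : z ∈ conjugates η) :
    ‖z‖ ≤ 1 := by
  obtain ⟨v, hvD, hv⟩ := X.exists_mem_sub_ne_zero hd
  obtain ⟨ψ, hψ, hψv⟩ := exists_addMonoidHom_smul_eq_mul
    (h.isFiniteType.isExpandingInteger hd hη hinfl).1.tower_top hz.2 hv
  obtain ⟨r, hr, hD⟩ := IsUniformlyDiscrete.exists_eq_of_dist_lt h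
  exact norm_le_one_of_meyer X.exists_dist_le_coveringRadius hr hD hη
    (smul_mem_sub_of_smul_subset hinfl) hz.1 hψ hvD hψv

end Inflation

theorem theorem4 (d : ℕ) (hd : 1 ≤ d) (X : Delone.DeloneSet (Euc d)) (η : ℝ) (hη : 1 < η)
    (hinfl : η • (X : Set (Euc d)) ⊆ (X : Set (Euc d))) :
    (IsFinitelyGenerated X → IsIntegral ℤ η) ∧
    (IsFiniteType X → IsPerron η ∨ IsLind η) ∧
    (IsFiniteType X → IsRepetitive X → IsPerron η) ∧
    (IsMeyer X → IsPisot η ∨ IsSalem η) := by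
  refine ⟨fun h => h.isIntegral hd hinfl, fun h => ?_, fun h hrep => ?_, fun h => ?_⟩
  · have hint := h.isExpandingInteger hd hη hinfl
    have hle : ∀ z ∈ conjugates η, ‖z‖ ≤ η := fun z => h.norm_le_of_mem_conjugates hd hη hinfl
    by_cases hex : ∃ z ∈ conjugates η, ‖z‖ = η
    · exact .inr ⟨hint, hle, hex⟩
    · push Not at hex
      exact .inl ⟨hint, fun z hz => (hle z hz).lt_of_ne (hex z hz)⟩
  · exact ⟨h.isExpandingInteger hd hη hinfl, fun z hz =>
      (h.norm_le_of_mem_conjugates hd hη hinfl hz).lt_of_ne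
        (h.norm_ne_of_isRepetitive hrep hd hη hinfl hz)⟩
  · have hint := h.isFiniteType.isExpandingInteger hd hη hinfl
    have hle : ∀ z ∈ conjugates η, ‖z‖ ≤ 1 :=
      fun z => h.norm_le_one_of_mem_conjugates hd hη hinfl
    by_cases hex : ∃ z ∈ conjugates η, ‖z‖ = 1
    · exact .inr ⟨hint, hle, hex⟩
    · push Not at hex
      exact .inl ⟨hint, fun z hz => (hle z hz).lt_of_ne (hex z hz)⟩
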